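/- Let $Q \in \mathbb{R}^{m \times m}$ be a symmetric matrix and let $D \in \mathbb{R}^{k \times m}$. For $(q,b) \in \mathbb{R}^m \times \mathbb{R}^k$ let $$ \mathrm{qp}_{\rm opt}(q,b) \;=\; \inf\left\{\, q^T z + \tfrac12\, z^T Q z \;\middle|\; z \in \mathbb{R}^m,\ Dz \ge b \,\right\} \in [-\infty,+\infty] $$ be the optimal value of the quadratic program (equal to $+\infty$ if the program is infeasible), and let $$ \mathrm{dom}(Q,D) \;=\; \{\, (q,b) \in \mathbb{R}^{m+k} \mid -\infty < \mathrm{qp}_{\rm opt}(q,b) < +\infty \,\} $$ be its domain of finiteness. Suppose that $Q$ is copositive on the recession cone $D_\infty = \{ v \in \mathbb{R}^m \mid Dv \ge 0 \}$, i.e. $v^T Q v \ge 0$ for all $v \in D_\infty$. Then for every open convex set $S \subseteq \mathbb{R}^{m+k}$ contained in $\mathrm{dom}(Q,D)$, the function $(q,b) \mapsto \mathrm{qp}_{\rm opt}(q,b)$ is dc (difference-of-convex) on $S$, i.e. there are convex functions $g, h : S \to \mathbb{R}$ with $\mathrm{qp}_{\rm opt}(q,b) = g(q,b) - h(q,b)$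 for all $(q,b) \in S$. -/

import Mathlib

open Matrix

namespace CopositiveQP

/-- The feasible region `P_D(b) = {z ∈ ℝᵐ | D z ≥ b}` (componentwise order). -/
def feasible {m k : ℕ} (D : Matrix (Fin k) (Fin m) ℝ) (b : Fin k → ℝ) : Set (Fin m → ℝ) :=
  {z | b ≤ D *ᵥ z}

/-- The recession cone `D_∞ = {v ∈ ℝᵐ | D v ≥ 0}`. -/
def recessionCone {m k : ℕ} (D : Matrix (Fin k) (Fin m) ℝ) : Set (Fin m → ℝ) :=
  {v | 0 ≤ D *ᵥ v}

/-- `Q` is copositive on the set `C`: `vᵀ Q v ≥ 0` for all `v ∈ C`. -/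
def CopositiveOn {m : ℕ} (Q : Matrix (Fin m) (Fin m) ℝ) (C : Set (Fin m → ℝ)) : Prop :=
  ∀ v ∈ C, 0 ≤ v ⬝ᵥ (Q *ᵥ v)

/-- The quadratic objective `ζ(z) = qᵀ z + ½ zᵀ Q z`. -/
noncomputable def objective {m : ℕ} (Q : Matrix (Fin m) (Fin m) ℝ) (q z : Fin m → ℝ) : ℝ :=
  q ⬝ᵥ z + (1 / 2) * (z ⬝ᵥ (Q *ᵥ z))

/-- The extended-real optimal value `qp_opt(q, b)`: the infimum of the objective over the feasible
region, equal to `+∞` for an infeasible program and to `-∞` for one that is unbounded below. -/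
noncomputable def qpOpt {m k : ℕ} (Q : Matrix (Fin m) (Fin m) ℝ) (D : Matrix (Fin k) (Fin m) ℝ)
    (p : (Fin m → ℝ) × (Fin k → ℝ)) : EReal :=
  ⨅ z ∈ feasible D p.2, ((objective Q p.1 z : ℝ) : EReal)

/-- The domain of finiteness `dom(Q, D) = {(q, b) | -∞ < qp_opt(q, b) < +∞}`. -/
def qpDom {m k : ℕ} (Q : Matrix (Fin m) (Fin m) ℝ) (D : Matrix (Fin k) (Fin m) ℝ) :
    Set ((Fin m → ℝ) × (Fin k → ℝ)) :=
  {p | ⊥ < qpOpt Q D p ∧ qpOpt Q D p < ⊤}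

/-- An extended-real-valued function is dc on `S` if on `S` it is finite and equal to the
difference of two real-valued functions that are convex on `S`
(`ConvexOn` includes the convexity of `S`). -/
def IsDCOn {E : Type*} [AddCommGroup E] [Module ℝ E] (S : Set E) (f : E → EReal) : Prop :=
  ∃ g h : E → ℝ, ConvexOn ℝ S g ∧ ConvexOn ℝ S h ∧ ∀ x ∈ S, f x = ((g x - h x : ℝ) : EReal)

end CopositiveQP

/-! By copositivity the minimum is attained wherever the value is finite
(`exists_isMinOn_objective`). A minimizer whose active set `I` is maximal is stationary on the
affine space cut out by `I`, and may be traded for a stationary point `T I x` depending linearly on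
the data `x = (q, b)` (`exists_selection_isMinOn`). So the value is always the objective at one of
finitely many linear selections. The other selections may be infeasible and undercut the value.
Hoffman's bound gives a feasible point within `C * violation` of each, so adding a penalty in this
radius (`objectiveBound`) lifts every candidate to at least the value, while a feasible candidate
has no penalty. The value is thus a finite minimum of functions built from linear ones by sums,
products, absolute values and maxima, all of which preserve dc. -/

namespace CopositiveQP

/-! ### Closure properties of dc functions. -/

section NonnegDC

variable {E : Type*} [AddCommGroup E] [Module ℝ E]

/-- A function that is the difference of two nonnegative convex functions. -/
def IsNonnegDC (f : E → ℝ) : Prop :=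
  ∃ g h : E → ℝ, ConvexOn ℝ Set.univ g ∧ ConvexOn ℝ Set.univ h ∧
    (∀ x, 0 ≤ g x) ∧ (∀ x, 0 ≤ h x) ∧ ∀ x, f x = g x - h x

namespace IsNonnegDC

lemma add {f₁ f₂ : E → ℝ} (h₁ : IsNonnegDC f₁) (h₂ : IsNonnegDC f₂) :
    IsNonnegDC (fun x => f₁ x + f₂ x) := by
  obtain ⟨g, h, hg, hh, g0, h0, e⟩ := h₁
  obtain ⟨g', h', hg', hh', g0', h0', e'⟩ := h₂
  exact ⟨fun x => g x + g' x, fun x => h x + h' x, hg.add hg', hh.add hh',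
    fun x => add_nonneg (g0 x) (g0' x), fun x => add_nonneg (h0 x) (h0' x),
    fun x => by simp only [e, e']; ring⟩

lemma neg {f : E → ℝ} (hf : IsNonnegDC f) : IsNonnegDC (fun x => -f x) := by
  obtain ⟨g, h, hg, hh, g0, h0, e⟩ := hf
  exact ⟨h, g, hh, hg, h0, g0, fun x => by simp only [e]; ring⟩

lemma sub {f₁ f₂ : E → ℝ} (h₁ : IsNonnegDC f₁) (h₂ : IsNonnegDC f₂) :
    IsNonnegDC (fun x => f₁ x - f₂ x) := by
  simpa only [sub_eq_add_neg] using h₁.add h₂.neg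

lemma max {f₁ f₂ : E → ℝ} (h₁ : IsNonnegDC f₁) (h₂ : IsNonnegDC f₂) :
    IsNonnegDC (fun x => Max.max (f₁ x) (f₂ x)) := by
  obtain ⟨g, h, hg, hh, g0, h0, e⟩ := h₁
  obtain ⟨g', h', hg', hh', g0', h0', e'⟩ := h₂
  refine ⟨fun x => Max.max (g x + h' x) (g' x + h x), fun x => h x + h' x,
    (hg.add hh').sup (hg'.add hh), hh.add hh',
    fun x => le_max_of_le_left (add_nonneg (g0 x) (h0' x)),
    fun x => add_nonneg (h0 x) (h0' x), fun x => ?_⟩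
  simp only [e, e']
  rw [← max_sub_sub_right]
  congr 1 <;> ring

lemma min {f₁ f₂ : E → ℝ} (h₁ : IsNonnegDC f₁) (h₂ : IsNonnegDC f₂) :
    IsNonnegDC (fun x => Min.min (f₁ x) (f₂ x)) := by
  simpa only [max_neg_neg, neg_neg] using (h₁.neg.max h₂.neg).neg

lemma abs {f : E → ℝ} (hf : IsNonnegDC f) : IsNonnegDC (fun x => |f x|) :=
  hf.max hf.neg

lemma const (c : ℝ) : IsNonnegDC (fun _ : E => c) :=
  ⟨fun _ => Max.max c 0, fun _ => Max.max (-c) 0, convexOn_const _ convex_univ,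
    convexOn_const _ convex_univ, fun _ => le_max_right _ _, fun _ => le_max_right _ _,
    fun _ => (posPart_sub_negPart c).symm⟩

lemma linearMap (l : E →ₗ[ℝ] ℝ) : IsNonnegDC (fun x => l x) := by
  have hc : ∀ l : E →ₗ[ℝ] ℝ, ConvexOn ℝ Set.univ (fun x => Max.max (l x) 0) := fun l =>
    (l.convexOn convex_univ).sup (convexOn_const 0 convex_univ)
  exact ⟨fun x => Max.max (l x) 0, fun x => Max.max (-l x) 0, hc l, hc (-l),
    fun _ => le_max_right _ _, fun _ => le_max_right _ _,
    fun x => (posPart_sub_negPart (l x)).symm⟩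

/-- Polarization: `fg = ½(f + g)² - (½f² + ½g²)`. Squares of nonnegative convex functions are
convex, which is why `IsNonnegDC` asks for nonnegative parts. -/
lemma mul_of_convexOn {f g : E → ℝ} (hf : ConvexOn ℝ Set.univ f) (hg : ConvexOn ℝ Set.univ g)
    (f0 : ∀ x, 0 ≤ f x) (g0 : ∀ x, 0 ≤ g x) : IsNonnegDC (fun x => f x * g x) := by
  have hsq : ∀ {u : E → ℝ}, ConvexOn ℝ Set.univ u → (∀ x, 0 ≤ u x) →
      ConvexOn ℝ Set.univ (fun x => (1 / 2 : ℝ) * u x ^ 2) := fun hu u0 =>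
    (hu.pow (fun x _ => u0 x) 2).smul (by norm_num : (0 : ℝ) ≤ 1 / 2)
  exact ⟨fun x => 1 / 2 * (f x + g x) ^ 2, fun x => 1 / 2 * f x ^ 2 + 1 / 2 * g x ^ 2,
    hsq (hf.add hg) (fun x => add_nonneg (f0 x) (g0 x)), (hsq hf f0).add (hsq hg g0),
    fun x => by positivity, fun x => by positivity, fun x => by ring⟩

lemma mul {f₁ f₂ : E → ℝ} (h₁ : IsNonnegDC f₁) (h₂ : IsNonnegDC f₂) :
    IsNonnegDC (fun x => f₁ x * f₂ x) := by
  obtain ⟨g, h, hg, hh, g0, h0, e⟩ := h₁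
  obtain ⟨g', h', hg', hh', g0', h0', e'⟩ := h₂
  have key := ((mul_of_convexOn hg hg' g0 g0').add (mul_of_convexOn hh hh' h0 h0')).sub
    ((mul_of_convexOn hg hh' g0 h0').add (mul_of_convexOn hh hg' h0 g0'))
  convert key using 2 with x
  rw [e, e']
  ring

lemma sum {ι : Type*} (s : Finset ι) {f : ι → E → ℝ} (hf : ∀ i ∈ s, IsNonnegDC (f i)) :
    IsNonnegDC (fun x => ∑ i ∈ s, f i x) := by
  classical
  induction s using Finset.induction_on with
  | empty => simpa using const 0
  | insert a s ha ih =>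
    simp only [Finset.sum_insert ha]
    exact (hf a (by simp)).add (ih fun i hi => hf i (by simp [hi]))

lemma inf' {ι : Type*} (s : Finset ι) (hs : s.Nonempty) {f : ι → E → ℝ}
    (hf : ∀ i ∈ s, IsNonnegDC (f i)) : IsNonnegDC (fun x => s.inf' hs fun i => f i x) := by
  induction hs using Finset.Nonempty.cons_induction with
  | singleton a => simpa using hf
  | cons a s ha hs ih =>
    simp only [Finset.inf'_cons hs]
    exact (hf a (by simp)).min (ih fun i hi => hf i (by simp [hi]))

lemma dotProduct {n : ℕ} {f g : E → Fin n → ℝ} (hf : ∀ i, IsNonnegDC fun x => f x i)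
    (hg : ∀ i, IsNonnegDC fun x => g x i) : IsNonnegDC (fun x => f x ⬝ᵥ g x) :=
  sum _ fun i _ => (hf i).mul (hg i)

end IsNonnegDC

end NonnegDC

/-- Split the projection `V → X` over its range and extend the resulting linear map to all of `X`;
off the range `T` is arbitrary. -/
lemma exists_linear_selection {X Z : Type*} [AddCommGroup X] [Module ℝ X] [AddCommGroup Z]
    [Module ℝ Z] (V : Submodule ℝ (X × Z)) :
    ∃ T : X →ₗ[ℝ] Z, ∀ x z, (x, z) ∈ V → (x, T x) ∈ V := by
  let π : V →ₗ[ℝ] X := (LinearMap.fst ℝ X Z).comp V.subtype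
  obtain ⟨s, hs⟩ := π.rangeRestrict.exists_rightInverse_of_surjective π.range_rangeRestrict
  obtain ⟨T, hT⟩ := LinearMap.exists_extend ((LinearMap.snd ℝ X Z).comp (V.subtype.comp s))
  refine ⟨T, fun x z hxz => ?_⟩
  have hx : x ∈ LinearMap.range π := ⟨⟨(x, z), hxz⟩, rfl⟩
  have h1 : T x = (s ⟨x, hx⟩ : X × Z).2 := LinearMap.congr_fun hT ⟨x, hx⟩
  have h2 : (s ⟨x, hx⟩ : X × Z).1 = x :=
    congrArg Subtype.val (LinearMap.congr_fun hs ⟨x, hx⟩)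
  have h3 : (x, T x) = (s ⟨x, hx⟩ : X × Z) := Prod.ext h2.symm h1
  rw [h3]
  exact (s ⟨x, hx⟩).2

/-! ### Hoffman's error bound. -/

section Hoffman

open scoped RealInnerProductSpace

variable {E : Type*} [NormedAddCommGroup E] [InnerProductSpace ℝ E] [FiniteDimensional ℝ E]
  {ι : Type*}

/-- If a dual-cone vector `z` had all `⟪a i, z⟫ ≤ 0`, then `-z` would lie in the cone and `-‖z‖² ≥
0`. So the sum is positive on the compact set of unit dual-cone vectors; homogeneity does the rest.
-/
lemma exists_bound_of_dual_cone (a : ι → E) (I : Finset ι) :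
    ∃ C : ℝ, 0 ≤ C ∧ ∀ z : E, (∀ v, (∀ i ∈ I, 0 ≤ ⟪a i, v⟫) → 0 ≤ ⟪z, v⟫) →
      ‖z‖ ≤ C * ∑ i ∈ I, max ⟪a i, z⟫ 0 := by
  let A : Set E := Metric.sphere 0 1 ∩ {z | ∀ v, (∀ i ∈ I, 0 ≤ ⟪a i, v⟫) → 0 ≤ ⟪z, v⟫}
  have hA : IsCompact A := by
    refine (isCompact_sphere 0 1).inter_right ?_
    simp only [Set.ofPred_forall]
    exact isClosed_iInter fun v => isClosed_iInter fun _ =>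
      isClosed_le continuous_const (by fun_prop)
  have hmem : ∀ z : E, z ≠ 0 → (∀ v, (∀ i ∈ I, 0 ≤ ⟪a i, v⟫) → 0 ≤ ⟪z, v⟫) →
      ‖z‖⁻¹ • z ∈ A := fun z hz h => by
    refine ⟨by simp [norm_smul, hz], fun v hv => ?_⟩
    rw [real_inner_smul_left]
    exact mul_nonneg (by positivity) (h v hv)
  rcases A.eq_empty_or_nonempty with hE | hne
  · refine ⟨0, le_rfl, fun z hz => ?_⟩
    by_cases h0 : z = 0
    · simp [h0]
    · exact absurd (hmem z h0 hz) (by simp [hE])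
  obtain ⟨u, hu, hmin⟩ := hA.exists_isMinOn hne
    (f := fun z => ∑ i ∈ I, max ⟪a i, z⟫ 0) (by fun_prop)
  set c := ∑ i ∈ I, max ⟪a i, u⟫ 0 with hc
  have hc0 : 0 < c := by
    by_contra hle
    have h0 : ∀ i ∈ I, max ⟪a i, u⟫ 0 = 0 :=
      (Finset.sum_eq_zero_iff_of_nonneg fun _ _ => le_max_right _ _).1
        (le_antisymm (not_lt.1 hle) (Finset.sum_nonneg fun _ _ => le_max_right _ _))
    have h1 := hu.2 (-u) fun i hi => by
      have := max_eq_right_iff.1 (h0 i hi)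
      simpa using this
    have h2 : ‖u‖ = 1 := by simpa using hu.1
    rw [inner_neg_right, real_inner_self_eq_norm_sq, h2] at h1
    norm_num at h1
  refine ⟨c⁻¹, by positivity, fun z hz => ?_⟩
  by_cases h0 : z = 0
  · simp [h0]
  have hn : 0 < ‖z‖ := norm_pos_iff.2 h0
  have h1 : c ≤ ∑ i ∈ I, max ⟪a i, ‖z‖⁻¹ • z⟫ 0 := hmin (hmem z h0 hz)
  have h2 : ∑ i ∈ I, max ⟪a i, ‖z‖⁻¹ • z⟫ 0 = ‖z‖⁻¹ * ∑ i ∈ I, max ⟪a i, z⟫ 0 := by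
    rw [Finset.mul_sum]
    refine Finset.sum_congr rfl fun i _ => ?_
    rw [real_inner_smul_right, mul_max_of_nonneg _ _ (by positivity), mul_zero]
  rw [h2, le_inv_mul_iff₀ hn] at h1
  rw [le_inv_mul_iff₀ hc0]
  linarith

/-- If finitely many affine functions are nonnegative at `z`, and those vanishing at `z` are
nondecreasing along `v`, then they stay nonnegative for a short time along `v`. -/
lemma exists_pos_forall_add_mul_nonneg [Fintype ι] (s w : ι → ℝ) (hs : ∀ i, 0 ≤ s i)
    (hw : ∀ i, s i = 0 → 0 ≤ w i) :
    ∃ ε > 0, ∀ t, 0 ≤ t → t ≤ ε → ∀ i, 0 ≤ s i + t * w i := by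
  have h : ∀ i, ∀ᶠ ε in nhdsWithin (0 : ℝ) (Set.Ioi 0), 0 ≤ s i + ε * w i := fun i => by
    rcases (hs i).eq_or_lt with h0 | h0
    · filter_upwards [self_mem_nhdsWithin] with ε hε
      rw [← h0, zero_add]
      exact mul_nonneg (le_of_lt hε) (hw i h0.symm)
    · have : ContinuousAt (fun ε : ℝ => s i + ε * w i) 0 := by fun_prop
      exact ((this.eventually (lt_mem_nhds (by simpa using h0))).filter_mono
        nhdsWithin_le_nhds).mono fun _ => le_of_lt
  obtain ⟨ε, hε, hε0⟩ := ((Filter.eventually_all.2 h).and self_mem_nhdsWithin).exists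
  have hε0 : 0 < ε := hε0
  refine ⟨ε, hε0, fun t ht htε i => ?_⟩
  rcases le_total 0 (w i) with hwi | hwi
  · exact add_nonneg (hs i) (mul_nonneg ht hwi)
  · nlinarith [hε i]

/-- Hoffman's error bound at the origin. -/
lemma exists_hoffman_bound_origin [Fintype ι] (a : ι → E) :
    ∃ C : ℝ, 0 ≤ C ∧ ∀ b : ι → ℝ, (∃ z, ∀ i, b i ≤ ⟪a i, z⟫) →
      ∃ z, (∀ i, b i ≤ ⟪a i, z⟫) ∧ ‖z‖ ≤ C * ∑ i, max (b i) 0 := by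
  classical
  choose C hC0 hC using exists_bound_of_dual_cone a
  -- The active set depends on `b`, so the constant must dominate all `C I`.
  refine ⟨∑ I, C I, Finset.sum_nonneg fun I _ => hC0 I, fun b hb => ?_⟩
  let P : Set E := {z | ∀ i, b i ≤ ⟪a i, z⟫}
  have hPc : IsClosed P := by
    simp only [P, Set.ofPred_forall]
    exact isClosed_iInter fun i => isClosed_le continuous_const (by fun_prop)
  have hPconv : Convex ℝ P := by
    simp only [P, Set.ofPred_forall]
    exact convex_iInter fun i => convex_halfSpace_ge (innerₛₗ ℝ (a i)).isLinear (b i)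
  obtain ⟨z, hz, hmin⟩ := exists_norm_eq_iInf_of_complete_convex hb hPc.isComplete hPconv 0
  have hvar := (norm_eq_iInf_iff_real_inner_le_zero hPconv hz).1 hmin
  refine ⟨z, hz, ?_⟩
  let I : Finset ι := {i | ⟪a i, z⟫ = b i}
  -- The least-norm feasible point lies in the dual cone of its active constraints: a short step
  -- along `v` stays feasible, so the variational inequality applies.
  have h1 := hC I z fun v hv => by
    obtain ⟨ε, hε, h⟩ := exists_pos_forall_add_mul_nonneg (fun i => ⟪a i, z⟫ - b i)
      (fun i => ⟪a i, v⟫) (fun i => sub_nonneg.2 (hz i))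
      (fun i hi => hv i (by simpa [I] using sub_eq_zero.1 hi))
    have h2 := hvar (z + ε • v) fun i => by
      have := h ε hε.le le_rfl i
      rw [inner_add_right, real_inner_smul_right]
      linarith
    rw [zero_sub, add_sub_cancel_left, inner_neg_left, real_inner_smul_right] at h2
    nlinarith
  calc ‖z‖ ≤ C I * ∑ i ∈ I, max ⟪a i, z⟫ 0 := h1
    _ = C I * ∑ i ∈ I, max (b i) 0 := by
      congr 1
      exact Finset.sum_congr rfl fun i hi => by rw [(Finset.mem_filter.1 hi).2]
    _ ≤ (∑ I, C I) * ∑ i, max (b i) 0 :=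
      mul_le_mul (Finset.single_le_sum (fun I _ => hC0 I) (Finset.mem_univ I))
        (Finset.sum_le_sum_of_subset_of_nonneg (Finset.subset_univ _)
          fun _ _ _ => le_max_right _ _)
        (Finset.sum_nonneg fun _ _ => le_max_right _ _) (Finset.sum_nonneg fun I _ => hC0 I)

end Hoffman

end CopositiveQP

namespace CopositiveQP

variable {m k : ℕ}

/-- Hoffman's error bound for the feasible region. -/
lemma exists_hoffman_bound (D : Matrix (Fin k) (Fin m) ℝ) :
    ∃ C : ℝ, 0 ≤ C ∧ ∀ (b : Fin k → ℝ) (z₀ : Fin m → ℝ), (feasible D b).Nonempty →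
      ∃ z ∈ feasible D b, ‖z - z₀‖ ≤ C * ∑ i, max (b i - (D *ᵥ z₀) i) 0 := by
  have hin : ∀ i (y : EuclideanSpace ℝ (Fin m)),
      inner ℝ (WithLp.toLp 2 (D i)) y = (D *ᵥ (y.ofLp)) i := fun i y => by
    rw [EuclideanSpace.inner_eq_star_dotProduct, dotProduct_comm]
    simp [mulVec]
  obtain ⟨C, hC0, hC⟩ := exists_hoffman_bound_origin
    (fun i => (WithLp.toLp 2 (D i) : EuclideanSpace ℝ (Fin m)))
  refine ⟨C, hC0, fun b z₀ ⟨z₁, hz₁⟩ => ?_⟩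
  obtain ⟨y, hy, hle⟩ := hC (fun i => b i - (D *ᵥ z₀) i) ⟨WithLp.toLp 2 (z₁ - z₀), fun i => by
    rw [hin, mulVec_sub]
    exact sub_le_sub_right (hz₁ i) _⟩
  refine ⟨z₀ + y.ofLp, fun i => ?_, ?_⟩
  · have := hy i
    rw [hin] at this
    rw [mulVec_add, Pi.add_apply]
    linarith
  · rw [add_sub_cancel_left]
    exact ((pi_norm_le_iff_of_nonneg (norm_nonneg _)).2
      fun i => PiLp.norm_apply_le y i).trans hle

/-! ### Attainment of the minimum. -/

lemma objective_add_smul {Q : Matrix (Fin m) (Fin m) ℝ} (hQ : Q.IsSymm) (q z w : Fin m → ℝ)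
    (t : ℝ) : objective Q q (z + t • w) =
      objective Q q z + t * ((q + Q *ᵥ z) ⬝ᵥ w) + t ^ 2 * (1 / 2 * (w ⬝ᵥ (Q *ᵥ w))) := by
  have h : z ⬝ᵥ (Q *ᵥ w) = (Q *ᵥ z) ⬝ᵥ w := by
    rw [dotProduct_mulVec, ← mulVec_transpose, hQ.eq]
  have h' : w ⬝ᵥ (Q *ᵥ z) = (Q *ᵥ z) ⬝ᵥ w := dotProduct_comm _ _
  simp only [objective, mulVec_add, mulVec_smul, dotProduct_add, add_dotProduct, smul_dotProduct,
    dotProduct_smul, smul_eq_mul, h, h']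
  ring

lemma objective_add {Q : Matrix (Fin m) (Fin m) ℝ} (hQ : Q.IsSymm) (q z w : Fin m → ℝ) :
    objective Q q (z + w) =
      objective Q q z + (q + Q *ᵥ z) ⬝ᵥ w + 1 / 2 * (w ⬝ᵥ (Q *ᵥ w)) := by
  simpa using objective_add_smul hQ q z w 1

lemma continuous_objective (Q : Matrix (Fin m) (Fin m) ℝ) (q : Fin m → ℝ) :
    Continuous (objective Q q) := by
  unfold objective
  fun_prop

lemma isClosed_feasible (D : Matrix (Fin k) (Fin m) ℝ) (b : Fin k → ℝ) :
    IsClosed (feasible D b) :=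
  isClosed_le continuous_const (by fun_prop)

lemma add_smul_mem_feasible {D : Matrix (Fin k) (Fin m) ℝ} {b : Fin k → ℝ} {z w : Fin m → ℝ}
    {t : ℝ} : z + t • w ∈ feasible D b ↔ ∀ i, 0 ≤ ((D *ᵥ z) i - b i) + t * (D *ᵥ w) i := by
  simp only [feasible, Set.mem_ofPred_eq, Pi.le_def, mulVec_add, mulVec_smul, Pi.add_apply,
    Pi.smul_apply, smul_eq_mul]
  exact forall_congr' fun i => by constructor <;> intro h <;> linarith

lemma nonneg_of_forall_mul_add_sq_nonneg {a c ε : ℝ} (hε : 0 < ε)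
    (h : ∀ t, 0 ≤ t → t ≤ ε → 0 ≤ t * a + t ^ 2 * c) : 0 ≤ a := by
  have h1 : ∀ᶠ t in nhdsWithin (0 : ℝ) (Set.Ioi 0), 0 ≤ a + t * c := by
    filter_upwards [Ioc_mem_nhdsGT hε] with t ht
    have := h t ht.1.le ht.2
    rw [show t * a + t ^ 2 * c = t * (a + t * c) by ring] at this
    exact nonneg_of_mul_nonneg_right this ht.1
  have h2 : Filter.Tendsto (fun t : ℝ => a + t * c) (nhdsWithin 0 (Set.Ioi 0)) (nhds a) := by
    have : Continuous (fun t : ℝ => a + t * c) := by fun_prop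
    simpa using (this.tendsto 0).mono_left nhdsWithin_le_nhds
  exact ge_of_tendsto h2 h1

lemma nonneg_of_forall_bddBelow {a c M : ℝ} (h : ∀ t, 0 ≤ t → M ≤ c + t * a) : 0 ≤ a := by
  by_contra ha
  have ha : a < 0 := not_le.1 ha
  have h0 := h 0 le_rfl
  have h1 := h ((M - c - 1) / a) (div_nonneg_of_nonpos (by linarith) ha.le)
  rw [div_mul_cancel₀ _ ha.ne] at h1
  linarith

/-- Otherwise there are points of unbounded norm that cannot be shortened. A limit direction `d` is
recessive with zero curvature, and retreating along `d` by half the norm contradicts this. -/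
lemma exists_norm_lt_of_copositiveOn {Q : Matrix (Fin m) (Fin m) ℝ}
    {D : Matrix (Fin k) (Fin m) ℝ} (hQ : Q.IsSymm) (hcop : CopositiveOn Q (recessionCone D))
    (q : Fin m → ℝ) (b : Fin k → ℝ) {M : ℝ} (hM : ∀ z ∈ feasible D b, M ≤ objective Q q z)
    (c : ℝ) : ∃ R : ℝ, ∀ z ∈ feasible D b, objective Q q z ≤ c → R < ‖z‖ →
      ∃ z' ∈ feasible D b, objective Q q z' ≤ objective Q q z ∧ ‖z'‖ < ‖z‖ := by
  by_contra! hcon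
  choose z hz hzc hzn hzmin using fun n : ℕ => hcon n
  have hpos : ∀ n, 0 < ‖z n‖ := fun n => (Nat.cast_nonneg n).trans_lt (hzn n)
  have hinv : Filter.Tendsto (fun n => ‖z n‖⁻¹) Filter.atTop (nhds 0) :=
    tendsto_inv_atTop_zero.comp
      (Filter.tendsto_atTop_mono (fun n => (hzn n).le) tendsto_natCast_atTop_atTop)
  obtain ⟨d, hd, φ, hφ, hlim⟩ := (isCompact_sphere (0 : Fin m → ℝ) 1).tendsto_subseq
    (x := fun n => ‖z n‖⁻¹ • z n) (fun n => by simp [norm_smul, (hpos n).ne'])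
  replace hinv := hinv.comp hφ.tendsto_atTop
  have hd1 : ‖d‖ = 1 := by simpa using hd
  have hcont : ∀ {F : (Fin m → ℝ) → ℝ}, Continuous F → Filter.Tendsto
      (fun n => F (‖z (φ n)‖⁻¹ • z (φ n))) Filter.atTop (nhds (F d)) := fun hF =>
    (hF.tendsto d).comp hlim
  have hquad : d ⬝ᵥ (Q *ᵥ d) ≤ 0 := by
    have h1 := hcont (F := fun y => 1 / 2 * (y ⬝ᵥ (Q *ᵥ y))) (by fun_prop)
    have h2 := ((hinv.pow 2).mul_const c).sub
      (hinv.mul (hcont (F := fun y => q ⬝ᵥ y) (by fun_prop)))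
    have h3 := le_of_tendsto_of_tendsto' h1 h2 fun n => by
      have h4 := hzc (φ n)
      have h5 := (hpos (φ n)).ne'
      simp only [objective] at h4
      simp only [Function.comp, mulVec_smul, dotProduct_smul, smul_dotProduct, smul_eq_mul]
      have h6 := mul_le_mul_of_nonneg_left h4 (sq_nonneg ‖z (φ n)‖⁻¹)
      nlinarith
    norm_num at h3
    linarith
  have hrec : d ∈ recessionCone D := fun i => by
    have h1 := hcont (F := fun y => (D *ᵥ y) i) (by fun_prop)
    have h2 := hinv.mul_const (b i)
    rw [zero_mul] at h2
    refine le_of_tendsto_of_tendsto' h2 h1 fun n => ?_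
    simp only [Function.comp, mulVec_smul, Pi.smul_apply, smul_eq_mul]
    exact mul_le_mul_of_nonneg_left (hz (φ n) i) (inv_nonneg.2 (norm_nonneg _))
  have hzero : d ⬝ᵥ (Q *ᵥ d) = 0 := le_antisymm hquad (hcop d hrec)
  -- The objective is affine along `y + t • d`, so a lower bound forces its slope to be nonnegative.
  have hgrad : ∀ y ∈ feasible D b, 0 ≤ (q + Q *ᵥ y) ⬝ᵥ d := fun y hy => by
    refine nonneg_of_forall_bddBelow (c := objective Q q y) (M := M) fun t ht => ?_
    have h1 := hM (y + t • d) (add_smul_mem_feasible.2 fun i =>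
      add_nonneg (sub_nonneg.2 (hy i)) (mul_nonneg ht (hrec i)))
    rw [objective_add_smul hQ, hzero] at h1
    linarith
  -- Where `(D *ᵥ d) i > 0` the slack grows like `‖z‖ * (D *ᵥ d) i`, twice what the retreat uses;
  -- where it vanishes the slack is unchanged.
  have hfeas : ∀ i, ∀ᶠ n in Filter.atTop,
      0 ≤ ((D *ᵥ z (φ n)) i - b i) + (-(‖z (φ n)‖ / 2)) * (D *ᵥ d) i := fun i => by
    have hi : 0 ≤ (D *ᵥ d) i := hrec i
    rcases hi.eq_or_lt with h0 | h0
    · exact Filter.Eventually.of_forall fun n => by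
        rw [← h0, mul_zero, add_zero]
        exact sub_nonneg.2 (hz (φ n) i)
    · have h1 := (hcont (F := fun y => (D *ᵥ y) i) (by fun_prop)).sub (hinv.mul_const (b i))
      rw [zero_mul, sub_zero] at h1
      filter_upwards [h1.eventually (lt_mem_nhds (half_lt_self h0))] with n hn
      have h5 := hpos (φ n)
      simp only [Function.comp, mulVec_smul, Pi.smul_apply, smul_eq_mul] at hn
      have h6 := mul_lt_mul_of_pos_left hn h5
      rw [mul_sub, mul_inv_cancel_left₀ h5.ne', mul_inv_cancel_left₀ h5.ne'] at h6
      linarith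
  obtain ⟨n, hn, hdist⟩ := ((Filter.eventually_all.2 hfeas).and
    (hlim.eventually (Metric.ball_mem_nhds d (by norm_num : (0 : ℝ) < 1 / 2)))).exists
  have h5 := hpos (φ n)
  refine absurd (hzmin (φ n) _ (add_smul_mem_feasible.2 hn) ?_) (not_le.2 ?_)
  · rw [objective_add_smul hQ, hzero]
    nlinarith [hgrad _ (hz (φ n))]
  · have h1 : z (φ n) + -(‖z (φ n)‖ / 2) • d =
        ‖z (φ n)‖ • ((‖z (φ n)‖⁻¹ • z (φ n) - d) + (1 / 2 : ℝ) • d) := by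
      rw [smul_add, smul_sub, smul_inv_smul₀ h5.ne', smul_smul]
      module
    have h2 : ‖‖z (φ n)‖⁻¹ • z (φ n) - d‖ < 1 / 2 := mem_ball_iff_norm.1 hdist
    have h3 := norm_add_le (‖z (φ n)‖⁻¹ • z (φ n) - d) ((1 / 2 : ℝ) • d)
    rw [norm_smul (1 / 2 : ℝ) d, hd1] at h3
    norm_num at h3
    rw [h1, norm_smul, norm_norm]
    exact mul_lt_of_lt_one_right h5 (by linarith)

/-- The Frank–Wolfe theorem: a copositive quadratic program that is feasible and bounded below
attains its minimum. -/
lemma exists_isMinOn_objective {Q : Matrix (Fin m) (Fin m) ℝ} {D : Matrix (Fin k) (Fin m) ℝ}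
    (hQ : Q.IsSymm) (hcop : CopositiveOn Q (recessionCone D)) {q : Fin m → ℝ} {b : Fin k → ℝ}
    {M : ℝ} (hM : ∀ z ∈ feasible D b, M ≤ objective Q q z) (hne : (feasible D b).Nonempty) :
    ∃ z ∈ feasible D b, IsMinOn (objective Q q) (feasible D b) z := by
  obtain ⟨z₀, hz₀⟩ := hne
  obtain ⟨R, hR⟩ := exists_norm_lt_of_copositiveOn hQ hcop q b hM (objective Q q z₀)
  have hK : ∀ r c : ℝ, IsCompact
      (Metric.closedBall 0 r ∩ (feasible D b ∩ {w | objective Q q w ≤ c})) := fun r c =>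
    (isCompact_closedBall _ _).inter_right ((isClosed_feasible D b).inter
      (isClosed_le (continuous_objective Q q) continuous_const))
  have hred : ∀ z ∈ feasible D b, objective Q q z ≤ objective Q q z₀ →
      ∃ w ∈ Metric.closedBall 0 R ∩ (feasible D b ∩ {w | objective Q q w ≤ objective Q q z₀}),
        objective Q q w ≤ objective Q q z := fun z hz hzc => by
    -- A least-norm point among those no worse than `z` cannot be shortened, so its norm is at most
    -- `R`.
    obtain ⟨w, hw, hmin⟩ := (hK ‖z‖ (objective Q q z)).exists_isMinOn
      ⟨z, by simp, hz, le_refl (objective Q q z)⟩ (f := fun w => ‖w‖) (by fun_prop)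
    have hwz : objective Q q w ≤ objective Q q z := hw.2.2
    refine ⟨w, ⟨?_, hw.2.1, hwz.trans hzc⟩, hwz⟩
    by_contra hwR
    obtain ⟨w', hw', hle, hlt⟩ := hR w hw.2.1 (hwz.trans hzc) (by simpa using hwR)
    have hwn : ‖w‖ ≤ ‖z‖ := by simpa using hw.1
    exact absurd (hmin ⟨by simpa using hlt.le.trans hwn, hw', hle.trans hwz⟩) (not_le.2 hlt)
  obtain ⟨w₀, hw₀, -⟩ := hred z₀ hz₀ le_rfl
  obtain ⟨z, hz, hmin⟩ := (hK R (objective Q q z₀)).exists_isMinOn ⟨w₀, hw₀⟩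
    (continuous_objective Q q).continuousOn
  refine ⟨z, hz.2.1, fun y hy => ?_⟩
  rcases le_total (objective Q q y) (objective Q q z₀) with h | h
  · obtain ⟨w, hw, hwy⟩ := hred y hy h
    exact (hmin hw).trans hwy
  · exact le_trans hz.2.2 h

/-! ### Stationary points and active sets. -/

/-- The triples `((q, b), z)` such that `z` is a stationary point of the objective on the affine
space where the constraints in `I` hold with equality. -/
def stationarySubmodule (Q : Matrix (Fin m) (Fin m) ℝ) (D : Matrix (Fin k) (Fin m) ℝ)
    (I : Finset (Fin k)) : Submodule ℝ (((Fin m → ℝ) × (Fin k → ℝ)) × (Fin m → ℝ)) where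
  carrier := {p | (∀ i ∈ I, (D *ᵥ p.2) i = p.1.2 i) ∧
    ∀ v, (∀ i ∈ I, (D *ᵥ v) i = 0) → (p.1.1 + Q *ᵥ p.2) ⬝ᵥ v = 0}
  add_mem' {p p'} hp hp' := by
    refine ⟨fun i hi => ?_, fun v hv => ?_⟩
    · simp [mulVec_add, hp.1 i hi, hp'.1 i hi]
    · have h1 := hp.2 v hv
      have h2 := hp'.2 v hv
      simp only [add_dotProduct, Prod.fst_add, Prod.snd_add, mulVec_add] at h1 h2 ⊢
      linarith
  zero_mem' := by simp
  smul_mem' c p hp := by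
    refine ⟨fun i hi => ?_, fun v hv => ?_⟩
    · simp [mulVec_smul, hp.1 i hi]
    · have h1 := hp.2 v hv
      simp only [add_dotProduct, Prod.smul_fst, Prod.smul_snd, mulVec_smul, smul_dotProduct,
        smul_eq_mul] at h1 ⊢
      rw [← mul_add, h1, mul_zero]

/-- Simplex ratio test: stop at the first constraint to become tight. -/
lemma exists_blocking_step {ι : Type*} [Fintype ι] (s w : ι → ℝ) (hs : ∀ i, 0 ≤ s i) {j : ι}
    (hj : w j < 0) :
    ∃ t, (∀ i, 0 ≤ s i + t * w i) ∧ ∃ i, w i < 0 ∧ s i + t * w i = 0 := by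
  classical
  obtain ⟨i, hi, hmin⟩ := Finset.exists_min_image (Finset.univ.filter fun i => w i < 0)
    (fun i => s i / (-w i)) ⟨j, by simpa using hj⟩
  have hi : w i < 0 := by simpa using hi
  have ht : 0 ≤ s i / (-w i) := div_nonneg (hs i) (by linarith)
  refine ⟨s i / (-w i), fun l => ?_, i, hi, ?_⟩
  · rcases lt_or_ge (w l) 0 with hl | hl
    · have := hmin l (by simpa using hl)
      rw [le_div_iff₀ (by linarith)] at this
      linarith
    · exact add_nonneg (hs l) (mul_nonneg ht hl)
  · rw [div_neg, neg_mul, div_mul_cancel₀ _ hi.ne, add_neg_cancel]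

/-- An optimal solution with maximal active set can be replaced by any linear selection of the
stationary points associated with that active set. -/
lemma exists_selection_isMinOn {Q : Matrix (Fin m) (Fin m) ℝ} {D : Matrix (Fin k) (Fin m) ℝ}
    (hQ : Q.IsSymm) {T : Finset (Fin k) → ((Fin m → ℝ) × (Fin k → ℝ)) → (Fin m → ℝ)}
    (hT : ∀ I x z, (x, z) ∈ stationarySubmodule Q D I → (x, T I x) ∈ stationarySubmodule Q D I)
    {x : (Fin m → ℝ) × (Fin k → ℝ)} {z₀ : Fin m → ℝ} (hz₀ : z₀ ∈ feasible D x.2)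
    (hmin₀ : IsMinOn (objective Q x.1) (feasible D x.2) z₀) :
    ∃ I, T I x ∈ feasible D x.2 ∧ IsMinOn (objective Q x.1) (feasible D x.2) (T I x) := by
  classical
  obtain ⟨I, hI⟩ := (Set.toFinite {I : Finset (Fin k) | ∃ z ∈ feasible D x.2,
    IsMinOn (objective Q x.1) (feasible D x.2) z ∧ ∀ i ∈ I, (D *ᵥ z) i = x.2 i}).exists_maximal
    ⟨∅, z₀, hz₀, hmin₀, by simp⟩
  obtain ⟨z, hz, hmin, hact⟩ := hI.prop
  have hmax : ∀ y ∈ feasible D x.2, IsMinOn (objective Q x.1) (feasible D x.2) y →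
      (∀ i ∈ I, (D *ᵥ y) i = x.2 i) → ∀ j, (D *ᵥ y) j = x.2 j → j ∈ I := fun y hy hymin hyI j hj =>
    hI.le_of_ge (y := insert j I) ⟨y, hy, hymin, by simpa [hj] using hyI⟩
      (Finset.subset_insert j I) (Finset.mem_insert_self j I)
  have hslack : ∀ i, 0 ≤ (D *ᵥ z) i - x.2 i := fun i => sub_nonneg.2 (hz i)
  have hdir : ∀ v, (∀ i ∈ I, (D *ᵥ v) i = 0) → 0 ≤ (x.1 + Q *ᵥ z) ⬝ᵥ v := fun v hv => by
    obtain ⟨ε, hε, h⟩ := exists_pos_forall_add_mul_nonneg (fun i => (D *ᵥ z) i - x.2 i)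
      (fun i => (D *ᵥ v) i) hslack
      (fun i hi => (hv i (hmax z hz hmin hact i (sub_eq_zero.1 hi))).ge)
    refine nonneg_of_forall_mul_add_sq_nonneg (c := 1 / 2 * (v ⬝ᵥ (Q *ᵥ v))) hε
      fun t ht htε => ?_
    have h1 : objective Q x.1 z ≤ _ := hmin (add_smul_mem_feasible.2 (h t ht htε))
    rw [objective_add_smul hQ] at h1
    linarith
  have hstat : ∀ v, (∀ i ∈ I, (D *ᵥ v) i = 0) → (x.1 + Q *ᵥ z) ⬝ᵥ v = 0 := fun v hv => by
    have h1 := hdir (-v) fun i hi => by simp [mulVec_neg, hv i hi]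
    rw [dotProduct_neg] at h1
    exact le_antisymm (by linarith) (hdir v hv)
  have hTx := hT I x z ⟨hact, hstat⟩
  have hflat : ∀ w, (∀ i ∈ I, (D *ᵥ w) i = 0) → (Q *ᵥ w) ⬝ᵥ w = 0 → ∀ t : ℝ,
      objective Q x.1 (z + t • w) = objective Q x.1 z := fun w hwI hwQ t => by
    rw [objective_add_smul hQ, hstat w hwI, dotProduct_comm w, hwQ]
    ring
  -- Along `w` the objective is constant, so a decreasing constraint could be followed until it is
  -- active at another minimizer, contradicting the maximality of `I`.
  have hnonneg : ∀ w, (∀ i ∈ I, (D *ᵥ w) i = 0) → (Q *ᵥ w) ⬝ᵥ w = 0 → ∀ j, 0 ≤ (D *ᵥ w) j :=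
      fun w hwI hwQ j => by
    by_contra hj
    obtain ⟨t, ht, i, hi, hi0⟩ := exists_blocking_step (fun i => (D *ᵥ z) i - x.2 i)
      (fun i => (D *ᵥ w) i) hslack (not_le.1 hj)
    refine hi.ne (hwI i (hmax (z + t • w) (add_smul_mem_feasible.2 ht) (fun y hy => ?_)
      (fun l hl => ?_) i ?_))
    · rw [Set.mem_ofPred_eq, hflat w hwI hwQ]
      exact hmin hy
    · simp [mulVec_add, mulVec_smul, hwI l hl, hact l hl]
    · simp only [mulVec_add, mulVec_smul, Pi.add_apply, Pi.smul_apply, smul_eq_mul]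
      linarith
  set w := T I x - z with hw
  have hTz : T I x = z + (1 : ℝ) • w := by simp [hw]
  have hwI : ∀ i ∈ I, (D *ᵥ w) i = 0 := fun i hi => by
    rw [hw, mulVec_sub, Pi.sub_apply, hact i hi, sub_eq_zero]
    exact hTx.1 i hi
  -- Both endpoints are stationary, so the gradient difference `Q *ᵥ w` annihilates `w`.
  have hwQ : (Q *ᵥ w) ⬝ᵥ w = 0 := by
    have h1 : (x.1 + Q *ᵥ T I x) ⬝ᵥ w = 0 := hTx.2 w hwI
    have h2 := hstat w hwI
    have h3 : Q *ᵥ w = (x.1 + Q *ᵥ T I x) - (x.1 + Q *ᵥ z) := by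
      rw [hw, mulVec_sub]
      abel
    rw [h3, sub_dotProduct, h1, h2, sub_zero]
  refine ⟨I, ?_, fun y hy => ?_⟩
  · rw [hTz]
    exact add_smul_mem_feasible.2 fun i => add_nonneg (hslack i)
      (mul_nonneg zero_le_one (hnonneg w hwI hwQ i))
  · rw [Set.mem_ofPred_eq, hTz, hflat w hwI hwQ]
    exact hmin hy

/-! ### Penalized candidates and the dc formula. -/

/-- The total violation of the constraints `D z ≥ b` at `z`. -/
noncomputable def violation (D : Matrix (Fin k) (Fin m) ℝ) (b : Fin k → ℝ) (z : Fin m → ℝ) : ℝ :=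
  ∑ i, max (b i - (D *ᵥ z) i) 0

/-- An upper bound for the objective at the points within distance `r` of `z`. -/
noncomputable def objectiveBound (Q : Matrix (Fin m) (Fin m) ℝ) (q z : Fin m → ℝ) (r : ℝ) : ℝ :=
  objective Q q z + (∑ i, |(q + Q *ᵥ z) i|) * r + 1 / 2 * (∑ i, ∑ j, |Q i j|) * r ^ 2

lemma dotProduct_le_sum_abs_mul (a w : Fin m → ℝ) {r : ℝ} (hw : ‖w‖ ≤ r) :
    a ⬝ᵥ w ≤ (∑ i, |a i|) * r := by
  rw [Finset.sum_mul]
  refine Finset.sum_le_sum fun i _ => (le_abs_self _).trans ?_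
  rw [abs_mul]
  exact mul_le_mul_of_nonneg_left ((norm_le_pi_norm w i).trans hw) (abs_nonneg _)

lemma dotProduct_mulVec_le (Q : Matrix (Fin m) (Fin m) ℝ) (w : Fin m → ℝ) {r : ℝ}
    (hw : ‖w‖ ≤ r) : w ⬝ᵥ (Q *ᵥ w) ≤ (∑ i, ∑ j, |Q i j|) * r ^ 2 := by
  have hr : ∀ i, |w i| ≤ r := fun i => (norm_le_pi_norm w i).trans hw
  simp only [dotProduct, mulVec, Finset.mul_sum, Finset.sum_mul]
  refine Finset.sum_le_sum fun i _ => Finset.sum_le_sum fun j _ => (le_abs_self _).trans ?_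
  rw [abs_mul, abs_mul]
  have := mul_le_mul (hr i) (hr j) (abs_nonneg _) ((abs_nonneg _).trans (hr i))
  nlinarith [abs_nonneg (Q i j)]

lemma objective_le_objectiveBound {Q : Matrix (Fin m) (Fin m) ℝ} (hQ : Q.IsSymm)
    (q z z' : Fin m → ℝ) {r : ℝ} (h : ‖z' - z‖ ≤ r) :
    objective Q q z' ≤ objectiveBound Q q z r := by
  have h1 := objective_add hQ q z (z' - z)
  rw [add_sub_cancel] at h1
  rw [h1, objectiveBound]
  have h2 := dotProduct_le_sum_abs_mul (q + Q *ᵥ z) _ h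
  have h3 := dotProduct_mulVec_le Q _ h
  linarith

lemma isNonnegDC_mulVec {E : Type*} [AddCommGroup E] [Module ℝ E] {n l : ℕ}
    (A : Matrix (Fin n) (Fin l) ℝ) {f : E → Fin l → ℝ} (hf : ∀ i, IsNonnegDC fun x => f x i)
    (i : Fin n) : IsNonnegDC fun x => (A *ᵥ f x) i :=
  IsNonnegDC.dotProduct (f := fun _ => A i) (fun _ => .const _) hf

lemma isNonnegDC_objectiveBound (Q : Matrix (Fin m) (Fin m) ℝ) (D : Matrix (Fin k) (Fin m) ℝ)
    (C : ℝ) (T : ((Fin m → ℝ) × (Fin k → ℝ)) →ₗ[ℝ] (Fin m → ℝ)) :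
    IsNonnegDC fun x : (Fin m → ℝ) × (Fin k → ℝ) =>
      objectiveBound Q x.1 (T x) (C * violation D x.2 (T x)) := by
  have hq : ∀ i, IsNonnegDC fun x : (Fin m → ℝ) × (Fin k → ℝ) => x.1 i := fun i =>
    .linearMap ((LinearMap.proj i).comp (LinearMap.fst ℝ (Fin m → ℝ) (Fin k → ℝ)))
  have hb : ∀ i, IsNonnegDC fun x : (Fin m → ℝ) × (Fin k → ℝ) => x.2 i := fun i =>
    .linearMap ((LinearMap.proj i).comp (LinearMap.snd ℝ (Fin m → ℝ) (Fin k → ℝ)))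
  have hT : ∀ i, IsNonnegDC fun x => T x i := fun i => .linearMap ((LinearMap.proj i).comp T)
  have hr : IsNonnegDC fun x : (Fin m → ℝ) × (Fin k → ℝ) => C * violation D x.2 (T x) :=
    (IsNonnegDC.const C).mul (.sum _ fun i _ => ((hb i).sub (isNonnegDC_mulVec D hT i)).max
      (.const 0))
  simp only [objectiveBound, objective, pow_two]
  exact (((IsNonnegDC.dotProduct hq hT).add ((IsNonnegDC.const _).mul
    (IsNonnegDC.dotProduct hT (isNonnegDC_mulVec Q hT)))).add
    ((IsNonnegDC.sum _ fun i _ => ((hq i).add (isNonnegDC_mulVec Q hT i)).abs).mul hr)).add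
    ((IsNonnegDC.const _).mul (hr.mul hr))

lemma nonempty_feasible_of_mem_qpDom {Q : Matrix (Fin m) (Fin m) ℝ}
    {D : Matrix (Fin k) (Fin m) ℝ} {x : (Fin m → ℝ) × (Fin k → ℝ)} (hx : x ∈ qpDom Q D) :
    (feasible D x.2).Nonempty := by
  by_contra h
  have h := Set.not_nonempty_iff_eq_empty.1 h
  exact hx.2.ne (by simp [qpOpt, h])

lemma exists_forall_le_objective_of_mem_qpDom {Q : Matrix (Fin m) (Fin m) ℝ}
    {D : Matrix (Fin k) (Fin m) ℝ} {x : (Fin m → ℝ) × (Fin k → ℝ)} (hx : x ∈ qpDom Q D) :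
    ∃ M : ℝ, ∀ z ∈ feasible D x.2, M ≤ objective Q x.1 z := by
  obtain ⟨M, -, hM⟩ := EReal.lt_iff_exists_real_btwn.1 hx.1
  exact ⟨M, fun z hz => EReal.coe_le_coe_iff.1 (hM.le.trans (iInf₂_le z hz))⟩

lemma qpOpt_eq_of_isMinOn {Q : Matrix (Fin m) (Fin m) ℝ} {D : Matrix (Fin k) (Fin m) ℝ}
    {x : (Fin m → ℝ) × (Fin k → ℝ)} {z : Fin m → ℝ} (hz : z ∈ feasible D x.2)
    (hmin : IsMinOn (objective Q x.1) (feasible D x.2) z) :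
    qpOpt Q D x = (objective Q x.1 z : ℝ) :=
  le_antisymm (iInf₂_le z hz) (le_iInf₂ fun _ hy => EReal.coe_le_coe_iff.2 (hmin hy))

/-- On its domain of finiteness, the optimal value of a copositive quadratic program agrees with
a globally defined difference of convex functions. -/
lemma exists_isNonnegDC_eq_qpOpt {Q : Matrix (Fin m) (Fin m) ℝ} {D : Matrix (Fin k) (Fin m) ℝ}
    (hQ : Q.IsSymm) (hcop : CopositiveOn Q (recessionCone D)) :
    ∃ F : (Fin m → ℝ) × (Fin k → ℝ) → ℝ, IsNonnegDC F ∧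
      ∀ x ∈ qpDom Q D, qpOpt Q D x = (F x : ℝ) := by
  choose T hT using fun I => exists_linear_selection (stationarySubmodule Q D I)
  obtain ⟨C, hC0, hC⟩ := exists_hoffman_bound D
  refine ⟨fun x => Finset.univ.inf' Finset.univ_nonempty fun I =>
    objectiveBound Q x.1 (T I x) (C * violation D x.2 (T I x)),
    .inf' _ _ fun I _ => isNonnegDC_objectiveBound Q D C (T I), fun x hx => ?_⟩
  have hne := nonempty_feasible_of_mem_qpDom hx
  obtain ⟨M, hM⟩ := exists_forall_le_objective_of_mem_qpDom hx
  obtain ⟨z₀, hz₀, hmin₀⟩ := exists_isMinOn_objective hQ hcop hM hne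
  obtain ⟨I, hI, hmin⟩ := exists_selection_isMinOn hQ (T := fun I => T I) hT hz₀ hmin₀
  rw [qpOpt_eq_of_isMinOn hI hmin]
  refine congrArg _ (le_antisymm (Finset.le_inf' _ _ fun J _ => ?_) ?_)
  -- Each penalized candidate dominates the objective at a nearby feasible point, hence the minimum.
  · obtain ⟨z, hz, hle⟩ := hC x.2 (T J x) hne
    exact (hmin hz).trans (objective_le_objectiveBound hQ _ _ _ hle)
  · have hv : violation D x.2 (T I x) = 0 :=
      Finset.sum_eq_zero fun i _ => max_eq_right (sub_nonpos.2 (hI i))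
    refine (Finset.inf'_le _ (Finset.mem_univ I)).trans_eq ?_
    simp [objectiveBound, hv]

end CopositiveQP

theorem mainTheorem12 {m k : ℕ} (Q : Matrix (Fin m) (Fin m) ℝ) (D : Matrix (Fin k) (Fin m) ℝ)
    (hQ : Q.IsSymm) (hcop : CopositiveQP.CopositiveOn Q (CopositiveQP.recessionCone D))
    (S : Set ((Fin m → ℝ) × (Fin k → ℝ))) (hSopen : IsOpen S) (hSconv : Convex ℝ S)
    (hSdom : S ⊆ CopositiveQP.qpDom Q D) :
    CopositiveQP.IsDCOn S (CopositiveQP.qpOpt Q D) := by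
  obtain ⟨F, ⟨g, h, hg, hh, -, -, hF⟩, hval⟩ := CopositiveQP.exists_isNonnegDC_eq_qpOpt hQ hcop
  exact ⟨g, h, hg.subset (Set.subset_univ S) hSconv, hh.subset (Set.subset_univ S) hSconv,
    fun x hx => by rw [hval x (hSdom hx), hF]⟩
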